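/- Let $\Omega$ be a finite set of states, $\Delta(\Omega)$ the simplex of probability vectors on $\Omega$, and $p\in\Delta(\Omega)$ a prior with $p(\omega)>0$ for all $\omega$. Let $A$ be a non-empty compact metric space of actions, and let the sender's utility $u_S:A\to\mathbb R$ and the receiver's utility $u_R:\Omega\times A\to\mathbb R$ be continuous. For $\mu\in\Delta(\Omega)$ put $$\mathbf V(\mu)=\mathrm{co}\Big(u_S\big(\arg\max_{a\in A}\textstyle\sum_\omega \mu(\omega)u_R(\omega,a)\big)\Big),\qquad \overline V(\mu)=\max\mathbf V(\mu),\quad \underline V(\mu)=\min\mathbf V(\mu).$$ Write $V\in\mathbf V$ if $V:\Delta(\Omega)\to\mathbb R$ is measurable with $V(\mu)\in\mathbf V(\mu)$ for all $\mu$. Let $\overline V_{CT}$ be the pointwise infimum of all quasiconcave functions on $\Delta(\Omega)$ that majorize $\overline V$, and $\underline V_{CT}$ the pointwise supremum of all quasiconvex functions on $\Delta(\Omega)$ that are majorized by $\underline V$. The value of mediation is $$\mathcal V_{MD}(p)=\sup\Big\{\int V\,d\tau:\ V\in\mathbf V,\ \tau\in\Delta(\Delta(\Omega)),\ \int\mu\,d\tau(\mu)=p,\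 \int V(\mu)(\mu-p)\,d\tau(\mu)=0\Big\}.$$ Let $\mathcal T_{CT}(p)$ be the set of $\tau\in\Delta(\Delta(\Omega))$ with $\int\mu\,d\tau(\mu)=p$ for which some $V\in\mathbf V$ is constant on $\mathrm{supp}(\tau)$. Say that $\tau\in\mathcal T_{CT}(p)$ attains $s\in\mathbb R$ if $s\in\bigcap_{\mu\in\mathrm{supp}(\tau)}\mathbf V(\mu)$, and that $s$ is attainable under cheap talk if some $\tau\in\mathcal T_{CT}(p)$ attains it. The cheap talk hull of $s$ is $$H(s)=\bigcup\{\mathrm{aff}(\mathrm{supp}(\tau))\cap\Delta(\Omega):\ \tau\in\mathcal T_{CT}(p)\text{ attains }s,\ |\mathrm{supp}(\tau)|<\infty\}.$$ Call $s$ improvable at $p$ (locally improvable at $p$) if there are $\mu\in\Delta(\Omega)$ (respectively $\mu\in H(s)$) and $\lambda\in[0,1)$ with $$\overline V_{CT}(\lambda\mu+(1-\lambda)p)>s>\underline V_{CT}(\mu).$$ **Theorem.** Let $s\ge\overline V(p)$ be attainable under cheap talk. (1) If $s$ is locally improvable at $p$, then $\mathcal V_{MD}(p)>s$. (2) If $s$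 is not improvable at $p$ and, in the degenerate case where $\underline V_{CT}(\mu)\ge s$ for all $\mu\in\Delta(\Omega)$, moreover $\overline V_{CT}(p)\le s$, then $\mathcal V_{MD}(p)=s$. -/

import Mathlib

open MeasureTheory

noncomputable section

namespace Mediation

variable {Ω A : Type*} [Fintype Ω]

/-- The receiver's best responses at the belief `μ`: maximizers of `𝔼_μ[u_R(ω, a)]` over `a`. -/
def bestResponses (uR : Ω → A → ℝ) (μ : Ω → ℝ) : Set A :=
  {a | ∀ a' : A, ∑ ω, μ ω * uR ω a' ≤ ∑ ω, μ ω * uR ω a}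

/-- The sender's indirect value correspondence
`𝐕(μ) = co (u_S (argmax_a 𝔼_μ[u_R(ω, a)]))`. -/
def valueCorr (uS : A → ℝ) (uR : Ω → A → ℝ) (μ : Ω → ℝ) : Set ℝ :=
  convexHull ℝ (uS '' bestResponses uR μ)

/-- The upper envelope `V̄(μ) = max 𝐕(μ)`
(at beliefs `𝐕(μ)` is non-empty and compact under the standing assumptions). -/
def upperValue (uS : A → ℝ) (uR : Ω → A → ℝ) (μ : Ω → ℝ) : ℝ :=
  sSup (valueCorr uS uR μ)

/-- The lower envelope `V̲(μ) = min 𝐕(μ)`. -/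
def lowerValue (uS : A → ℝ) (uR : Ω → A → ℝ) (μ : Ω → ℝ) : ℝ :=
  sInf (valueCorr uS uR μ)

/-- `V ∈ 𝐕`: the function `V` is a measurable selection of the value correspondence. -/
def IsSelection (uS : A → ℝ) (uR : Ω → A → ℝ) (V : stdSimplex ℝ Ω → ℝ) : Prop :=
  Measurable V ∧ ∀ μ : stdSimplex ℝ Ω, V μ ∈ valueCorr uS uR (μ : Ω → ℝ)

/-- `T_BP(p)`: distributions of posteriors `τ ∈ Δ(Δ(Ω))` with `∫ μ dτ(μ) = p`. -/
def bayesPlausible (p : Ω → ℝ) : Set (ProbabilityMeasure (stdSimplex ℝ Ω)) :=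
  {τ | ∀ ω : Ω, ∫ μ : stdSimplex ℝ Ω, (μ : Ω → ℝ) ω ∂(τ : Measure (stdSimplex ℝ Ω)) = p ω}

/-- The topological support of a distribution of posteriors. -/
def supp (τ : ProbabilityMeasure (stdSimplex ℝ Ω)) : Set (stdSimplex ℝ Ω) :=
  (τ : Measure (stdSimplex ℝ Ω)).support

/-- `T_CT(p)`: Bayes-plausible distributions of posteriors for which some measurable selection of
`𝐕` is constant on the support. -/
def cheapTalk (uS : A → ℝ) (uR : Ω → A → ℝ) (p : Ω → ℝ) :
    Set (ProbabilityMeasure (stdSimplex ℝ Ω)) :=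
  {τ | τ ∈ bayesPlausible p ∧
    ∃ V : stdSimplex ℝ Ω → ℝ, IsSelection uS uR V ∧ ∃ c : ℝ, ∀ μ ∈ supp τ, V μ = c}

/-- `τ` attains the value `s` under cheap talk with prior `p`:
`τ ∈ T_CT(p)` and `s ∈ ⋂_{μ ∈ supp τ} 𝐕(μ)`. -/
def AttainsCT (uS : A → ℝ) (uR : Ω → A → ℝ) (p : Ω → ℝ)
    (τ : ProbabilityMeasure (stdSimplex ℝ Ω)) (s : ℝ) : Prop :=
  τ ∈ cheapTalk uS uR p ∧ ∀ μ ∈ supp τ, s ∈ valueCorr uS uR (μ : Ω → ℝ)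

/-- The value `s` is attainable under cheap talk with prior `p`. -/
def AttainableCT (uS : A → ℝ) (uR : Ω → A → ℝ) (p : Ω → ℝ) (s : ℝ) : Prop :=
  ∃ τ : ProbabilityMeasure (stdSimplex ℝ Ω), AttainsCT uS uR p τ s

/-- `V̄_CT`: the quasiconcave envelope of `𝐕`, that is, the pointwise infimum of all quasiconcave
functions on `Δ(Ω)` that majorize `V̄`. -/
def upperCT (uS : A → ℝ) (uR : Ω → A → ℝ) (μ : Ω → ℝ) : ℝ :=
  sInf {y | ∃ f : (Ω → ℝ) → ℝ, QuasiconcaveOn ℝ (stdSimplex ℝ Ω) f ∧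
    (∀ ν ∈ stdSimplex ℝ Ω, upperValue uS uR ν ≤ f ν) ∧ y = f μ}

/-- `V̲_CT`: the quasiconvex envelope of `𝐕`, that is, the pointwise supremum of all quasiconvex
functions on `Δ(Ω)` that are majorized by `V̲`. -/
def lowerCT (uS : A → ℝ) (uR : Ω → A → ℝ) (μ : Ω → ℝ) : ℝ :=
  sSup {y | ∃ f : (Ω → ℝ) → ℝ, QuasiconvexOn ℝ (stdSimplex ℝ Ω) f ∧
    (∀ ν ∈ stdSimplex ℝ Ω, f ν ≤ lowerValue uS uR ν) ∧ y = f μ}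

/-- The cheap talk hull `H(s)`: the union of `aff(supp τ) ∩ Δ(Ω)` over all finitely supported
`τ ∈ T_CT(p)` that attain `s`. -/
def cheapTalkHull (uS : A → ℝ) (uR : Ω → A → ℝ) (p : Ω → ℝ) (s : ℝ) : Set (Ω → ℝ) :=
  {μ | ∃ τ : ProbabilityMeasure (stdSimplex ℝ Ω), AttainsCT uS uR p τ s ∧ (supp τ).Finite ∧
    μ ∈ (affineSpan ℝ ((fun ν : stdSimplex ℝ Ω => (ν : Ω → ℝ)) '' supp τ) : Set (Ω → ℝ)) ∩
      stdSimplex ℝ Ω}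

/-- `s` is improvable at `p`: for some `μ ∈ Δ(Ω)` and `t ∈ [0, 1)`,
`V̄_CT(t μ + (1 - t) p) > s > V̲_CT(μ)`. -/
def Improvable (uS : A → ℝ) (uR : Ω → A → ℝ) (p : Ω → ℝ) (s : ℝ) : Prop :=
  ∃ μ ∈ stdSimplex ℝ Ω, ∃ t ∈ Set.Ico (0 : ℝ) 1,
    s < upperCT uS uR (t • μ + (1 - t) • p) ∧ lowerCT uS uR μ < s

/-- `s` is locally improvable at `p`: the same with `μ ∈ H(s)`. -/
def LocallyImprovable (uS : A → ℝ) (uR : Ω → A → ℝ) (p : Ω → ℝ) (s : ℝ) : Prop :=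
  ∃ μ ∈ cheapTalkHull uS uR p s, ∃ t ∈ Set.Ico (0 : ℝ) 1,
    s < upperCT uS uR (t • μ + (1 - t) • p) ∧ lowerCT uS uR μ < s

/-- The pairs `(τ, V)` available to the mediator: `V` is a measurable selection of `𝐕`,
`∫ μ dτ = p` and `∫ V(μ) (μ - p) dτ = 0` (truth-telling). -/
def MediationFeasible (uS : A → ℝ) (uR : Ω → A → ℝ) (p : Ω → ℝ)
    (τ : ProbabilityMeasure (stdSimplex ℝ Ω)) (V : stdSimplex ℝ Ω → ℝ) : Prop :=
  IsSelection uS uR V ∧ τ ∈ bayesPlausible p ∧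
    ∀ ω : Ω, ∫ μ : stdSimplex ℝ Ω, V μ * ((μ : Ω → ℝ) ω - p ω)
      ∂(τ : Measure (stdSimplex ℝ Ω)) = 0

/-- The sender's optimal value under mediation: the supremum of `∫ V dτ` over feasible pairs. -/
def mediationValue (uS : A → ℝ) (uR : Ω → A → ℝ) (p : Ω → ℝ) : ℝ :=
  sSup {v | ∃ (τ : ProbabilityMeasure (stdSimplex ℝ Ω)) (V : stdSimplex ℝ Ω → ℝ),
    MediationFeasible uS uR p τ V ∧ v = ∫ μ, V μ ∂(τ : Measure (stdSimplex ℝ Ω))}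

end Mediation

end

/-! Given Bayes plausibility, truth-telling is the same as `∫ (V - s)(μ - p) dτ = 0`. Split `V - s`
into its positive and negative parts, with masses `α`, `β` and barycenters `x`, `y`. Then `α (x - p)
= β (y - p)`, and the plan yields more than `s` exactly when `α > β`. In that case, if `β > 0`, `x =
t y + (1 - t) p` with `t = β / α < 1`. Moreover `x` is a mixture of beliefs worth more than `s` and
`y` of beliefs worth less, which by `lt_upperCT_iff` and `lowerCT_lt_iff` is improvability. If `β =
0` then `x = p`, which leads to improvability with `t = 0` or to the excluded degenerate case.
Barycenters lie in the relevant hulls, closed or not, by `inv_smul_integral_mem`.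

Conversely, beliefs averaging to `x` and to `μ`, each group with one common value
(`exists_gt_mem_convexHull_valueCorr` and its mirror image), can be weighted so that their
contributions to truth-telling cancel while leaving a net gain. Their mean is off the prior. The
remaining mass restores it with beliefs of value exactly `s`, which do not affect the balance of `V
- s`. This is where `μ ∈ H(s)` enters: `p` can be pushed slightly away from `μ` inside the hull of
the support. -/

noncomputable section

namespace Mediation

open Set Filter Topology

/-! ### Elementary facts on convex combinations. -/

section Convexity

variable {E : Type*} [AddCommGroup E] [Module ℝ E]

/-- If `x` is a convex combination of points `z i` and each segment from `x` to `z i` meets `W`,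
then `x` lies in the convex hull of `W`. -/
theorem mem_convexHull_of_segments {ι : Type*} [Fintype ι] {W : Set E} {x : E} (w : ι → ℝ)
    (z y : ι → E) (hw : ∀ i, 0 ≤ w i) (hw1 : ∑ i, w i = 1) (hx : ∑ i, w i • z i = x)
    (hy : ∀ i, y i ∈ segment ℝ x (z i)) (hyW : ∀ i, y i ∈ W) : x ∈ convexHull ℝ W := by
  by_cases hex : ∃ i, y i = x
  · obtain ⟨i, hi⟩ := hex
    exact subset_convexHull ℝ W (hi ▸ hyW i)
  push Not at hex
  have hθ : ∀ i, ∃ θ : ℝ, 0 < θ ∧ θ ≤ 1 ∧ y i = x + θ • (z i - x) := by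
    intro i
    obtain ⟨θ, hθ, h⟩ := (segment_eq_image' ℝ x (z i)) ▸ hy i
    refine ⟨θ, lt_of_le_of_ne hθ.1 ?_, hθ.2, h.symm⟩
    rintro rfl
    exact hex i (by simpa using h.symm)
  choose θ h0 h1 hyθ using hθ
  -- With weights `w i / θ i` the displacements `y i - x = θ i • (z i - x)` sum to `∑ w i • (z i -
  -- x) = 0`, so `x` is the center of mass of the `y i`.
  have hge : ∀ i, w i ≤ w i / θ i := fun i => by
    rw [le_div_iff₀ (h0 i)]
    exact mul_le_of_le_one_right (hw i) (h1 i)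
  have hpos : 0 < ∑ i, w i / θ i :=
    lt_of_lt_of_le (by rw [hw1]; exact one_pos) (Finset.sum_le_sum fun i _ => hge i)
  have hmem := Finset.univ.centerMass_mem_convexHull (R := ℝ) (s := W) (w := fun i => w i / θ i)
    (z := y) (fun i _ => (hw i).trans (hge i)) hpos (fun i _ => hyW i)
  convert hmem using 1
  rw [Finset.centerMass, eq_inv_smul_iff₀ hpos.ne']
  have : ∀ i, (w i / θ i) • y i = (w i / θ i) • x + (w i • z i - w i • x) := by
    intro i
    rw [hyθ i, smul_add, smul_smul, div_mul_cancel₀ _ (h0 i).ne', smul_sub]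
  simp only [this, Finset.sum_add_distrib, Finset.sum_sub_distrib, ← Finset.sum_smul, hx, hw1]
  simp

/-- A convex combination with positive weights can be moved slightly away from any point of the
affine span without leaving the convex hull. -/
theorem exists_sub_smul_mem_convexHull {ι : Type*} [Fintype ι] {z : ι → E} {w : ι → ℝ}
    (hw : ∀ i, 0 < w i) (hw1 : ∑ i, w i = 1) {q : E} (hq : q ∈ affineSpan ℝ (range z)) :
    ∃ δ > 0, ∑ i, w i • z i - (δ : ℝ) • (q - ∑ i, w i • z i) ∈ convexHull ℝ (range z) := by
  obtain ⟨c, hc1, hc⟩ := eq_affineCombination_of_mem_affineSpan_of_fintype hq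
  rw [Finset.affineCombination_eq_linear_combination _ _ _ hc1] at hc
  -- Moving away from `q` replaces `w i` by `w i - δ (c i - w i)`: the sum stays 1, and strict
  -- positivity of `w` keeps the weights nonnegative for small `δ`.
  have hev : ∀ᶠ δ in 𝓝[>] (0 : ℝ), ∀ i, 0 ≤ w i - δ * (c i - w i) := by
    refine eventually_all.2 fun i => ?_
    have ht : Tendsto (fun δ : ℝ => w i - δ * (c i - w i)) (𝓝[>] 0) (𝓝 (w i)) := by
      have : Continuous fun δ : ℝ => w i - δ * (c i - w i) := by fun_prop
      simpa using (this.tendsto 0).mono_left nhdsWithin_le_nhds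
    exact (ht.eventually (lt_mem_nhds (hw i))).mono fun _ h => h.le
  obtain ⟨δ, hδ, hδ0⟩ := (hev.and self_mem_nhdsWithin).exists
  refine ⟨δ, hδ0, mem_convexHull_of_exists_fintype (fun i => w i - δ * (c i - w i)) z hδ ?_
    (fun i => mem_range_self i) ?_⟩
  · rw [Finset.sum_sub_distrib, ← Finset.mul_sum, Finset.sum_sub_distrib, hc1, hw1]
    simp
  · simp only [hc, sub_smul, mul_smul, Finset.sum_sub_distrib, ← Finset.smul_sum]

end Convexity

/-! ### Barycenters in convex sets that need not be closed. -/

section Barycenter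

universe u

/-- In finite dimension, a point outside a convex set is separated from it by a nonzero
functional. -/
theorem exists_ne_zero_forall_nonpos {E : Type*} [NormedAddCommGroup E] [NormedSpace ℝ E]
    [FiniteDimensional ℝ E] {C : Set E} (hC : Convex ℝ C) (hne : C.Nonempty) (h0 : (0 : E) ∉ C) :
    ∃ g : StrongDual ℝ E, g ≠ 0 ∧ ∀ c ∈ C, g c ≤ 0 := by
  by_cases hint : (interior C).Nonempty
  · obtain ⟨g, hg, hgC⟩ := geometric_hahn_banach_of_nonempty_interior_point hC
      (fun h => h0 (interior_subset h)) hint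
    exact ⟨g, hg, fun c hc => by simpa using hgC c hc⟩
  -- With empty interior, `C` lies in a proper affine subspace. A functional vanishing on its
  -- direction is constant on `C`, and its sign can be chosen.
  · rw [hC.interior_nonempty_iff_affineSpan_eq_top,
      AffineSubspace.affineSpan_eq_top_iff_vectorSpan_eq_top_of_nonempty ℝ E E hne] at hint
    obtain ⟨g, hg, hgV⟩ := Submodule.exists_le_ker_of_lt_top _ (lt_top_iff_ne_top.2 hint)
    obtain ⟨c₀, hc₀⟩ := hne
    have hconst : ∀ c ∈ C, g c = g c₀ := fun c hc => by
      have := hgV (vsub_mem_vectorSpan ℝ hc hc₀)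
      rw [LinearMap.mem_ker, vsub_eq_sub, map_sub, sub_eq_zero] at this
      exact this
    have hg' : LinearMap.toContinuousLinearMap g ≠ 0 := by simpa using hg
    rcases le_total (g c₀) 0 with h | h
    · exact ⟨LinearMap.toContinuousLinearMap g, hg', fun c hc => by
        simpa [hconst c hc] using h⟩
    · exact ⟨-LinearMap.toContinuousLinearMap g, neg_ne_zero.2 hg', fun c hc => by
        simpa [hconst c hc] using h⟩

/-- If a nonnegative weight `w` of positive total mass lives where `f` takes values in the convex
set `C`, and the weighted mean of `f` vanishes, then `0 ∈ C`; the set `C` need not be closed. -/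
theorem zero_mem_of_integral_smul_eq_zero {X : Type*} [MeasurableSpace X] {m : Measure X}
    {w : X → ℝ} (hw : ∀ x, 0 ≤ w x) (hw1 : 0 < ∫ x, w x ∂m) (n : ℕ) :
    ∀ {E : Type u} [NormedAddCommGroup E] [NormedSpace ℝ E] [FiniteDimensional ℝ E]
      (_ : Module.finrank ℝ E = n) {C : Set E} (_ : Convex ℝ C) {f : X → E}
      (_ : ∀ᵐ x ∂m, 0 < w x → f x ∈ C) (_ : Integrable (fun x => w x • f x) m)
      (_ : ∫ x, w x • f x ∂m = 0), (0 : E) ∈ C := by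
  induction n using Nat.strong_induction_on with
  | _ n ih =>
  intro E _ _ _ hn C hC f hf hfi hf0
  by_contra h0
  have hne : C.Nonempty := by
    by_contra hne
    rw [not_nonempty_iff_eq_empty] at hne
    have : w =ᵐ[m] 0 := by
      filter_upwards [hf] with x hx
      refine le_antisymm (not_lt.1 fun h => ?_) (hw x)
      simpa [hne] using hx h
    rw [integral_congr_ae this] at hw1
    simp at hw1
  obtain ⟨g, hg, hgC⟩ := exists_ne_zero_forall_nonpos hC hne h0
  have hgi : Integrable (fun x => g (w x • f x)) m := g.integrable_comp hfi
  have hg0 : ∫ x, -g (w x • f x) ∂m = 0 := by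
    rw [integral_neg, g.integral_comp_comm hfi, hf0, map_zero, neg_zero]
  have hnn : 0 ≤ᵐ[m] fun x => -g (w x • f x) := by
    filter_upwards [hf] with x hx
    rcases (hw x).eq_or_lt with h | h
    · simp [← h]
    · have := hgC _ (hx h)
      simp only [map_smul, smul_eq_mul, Pi.zero_apply]
      nlinarith
  have hae := (integral_eq_zero_iff_of_nonneg_ae hnn hgi.neg).1 hg0
  -- Since `g ≤ 0` on `C` and the weighted mean of `g ∘ f` is zero, `f` lies in `ker g` almost
  -- everywhere on `{w > 0}`. Projecting `f` to `ker g` lowers the dimension, so induction applies.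
  obtain ⟨π, hπ⟩ := Submodule.ClosedComplemented.of_finiteDimensional g.ker
  have hlt : Module.finrank ℝ g.ker < n := by
    rw [← hn]
    refine Submodule.finrank_lt fun h => hg ?_
    ext x
    have : x ∈ g.ker := h ▸ Submodule.mem_top
    simpa using this
  have := ih _ hlt rfl (C := (g.ker).subtype ⁻¹' C) (hC.linear_preimage _)
    (f := fun x => π (f x)) ?_ ?_ ?_
  · exact h0 (by simpa using this)
  · filter_upwards [hf, hae] with x hx hgx hwx
    have hk : f x ∈ g.ker := by
      have : w x * g (f x) = 0 := by simpa using hgx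
      simpa [hwx.ne'] using this
    have : π (f x) = ⟨f x, hk⟩ := hπ ⟨f x, hk⟩
    simpa [this] using hx hwx
  · simpa using π.integrable_comp hfi
  · have := π.integral_comp_comm hfi
    rw [hf0, map_zero] at this
    simpa using this

/-- The weighted mean of a function with values in a finite-dimensional convex set lies in that set,
even if the set is not closed. -/
theorem inv_smul_integral_mem {X : Type*} [MeasurableSpace X] {m : Measure X}
    {E : Type u} [NormedAddCommGroup E] [NormedSpace ℝ E] [FiniteDimensional ℝ E]
    {w : X → ℝ} (hw : ∀ x, 0 ≤ w x) (hwi : Integrable w m) (hw1 : 0 < ∫ x, w x ∂m)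
    {C : Set E} (hC : Convex ℝ C) {f : X → E} (hf : ∀ x, 0 < w x → f x ∈ C)
    (hfi : Integrable (fun x => w x • f x) m) :
    (∫ x, w x ∂m)⁻¹ • ∫ x, w x • f x ∂m ∈ C := by
  set b := (∫ x, w x ∂m)⁻¹ • ∫ x, w x • f x ∂m with hb
  have hbi : Integrable (fun x => w x • b) m := hwi.smul_const b
  have h := zero_mem_of_integral_smul_eq_zero hw hw1 _ rfl (hC.translate_preimage_right b)
    (f := fun x => f x - b) (Eventually.of_forall fun x hx => by simpa using hf x hx)
    (by simp only [smul_sub]; exact hfi.sub hbi) ?_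
  · simpa using h
  · simp only [smul_sub]
    rw [integral_sub hfi hbi, integral_smul_const, hb, smul_inv_smul₀ hw1.ne', sub_self]

end Barycenter

/-! ### The value correspondence and its quasiconcave envelope. -/

section Correspondence

variable {Ω A : Type*} [Fintype Ω]

/-- A convex hull in `ℝ` is order-connected, so one witness on each side suffices; no maximum or
minimum need be attained. -/
theorem mem_valueCorr_iff {uS : A → ℝ} {uR : Ω → A → ℝ} {μ : Ω → ℝ} {c : ℝ} :
    c ∈ valueCorr uS uR μ ↔
      (∃ a ∈ bestResponses uR μ, uS a ≤ c) ∧ ∃ a ∈ bestResponses uR μ, c ≤ uS a := by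
  constructor
  · intro hc
    constructor
    · by_contra! h
      have : valueCorr uS uR μ ⊆ Ioi c :=
        convexHull_min (by rintro _ ⟨a, ha, rfl⟩; exact h a ha) (convex_Ioi c)
      exact lt_irrefl c (this hc)
    · by_contra! h
      have : valueCorr uS uR μ ⊆ Iio c :=
        convexHull_min (by rintro _ ⟨a, ha, rfl⟩; exact h a ha) (convex_Iio c)
      exact lt_irrefl c (this hc)
  · rintro ⟨⟨a, ha, hac⟩, b, hb, hcb⟩
    refine segment_subset_convexHull (mem_image_of_mem uS ha) (mem_image_of_mem uS hb) ?_
    rw [segment_eq_Icc (hac.trans hcb)]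
    exact ⟨hac, hcb⟩

theorem apply_mem_valueCorr {uS : A → ℝ} {uR : Ω → A → ℝ} {μ : Ω → ℝ} {a : A}
    (ha : a ∈ bestResponses uR μ) : uS a ∈ valueCorr uS uR μ :=
  subset_convexHull ℝ _ (mem_image_of_mem uS ha)

theorem abs_le_of_mem_valueCorr {uS : A → ℝ} {uR : Ω → A → ℝ} {M : ℝ} (hM : ∀ a, |uS a| ≤ M)
    {μ : Ω → ℝ} {c : ℝ} (hc : c ∈ valueCorr uS uR μ) : |c| ≤ M := by
  obtain ⟨⟨a, -, ha⟩, b, -, hb⟩ := mem_valueCorr_iff.1 hc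
  exact abs_le.2 ⟨(abs_le.1 (hM a)).1.trans ha, hb.trans (abs_le.1 (hM b)).2⟩

theorem lt_upperValue_iff {uS : A → ℝ} {uR : Ω → A → ℝ} {M : ℝ} (hM : ∀ a, |uS a| ≤ M)
    {μ : Ω → ℝ} (hne : (bestResponses uR μ).Nonempty) {s : ℝ} :
    s < upperValue uS uR μ ↔ ∃ a ∈ bestResponses uR μ, s < uS a := by
  constructor
  · intro h
    obtain ⟨c, hc, hsc⟩ := exists_lt_of_lt_csSup
      ((hne.image uS).mono (subset_convexHull ℝ _)) h
    obtain ⟨-, a, ha, hca⟩ := mem_valueCorr_iff.1 hc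
    exact ⟨a, ha, hsc.trans_le hca⟩
  · rintro ⟨a, ha, hsa⟩
    exact hsa.trans_le (le_csSup ⟨M, fun c hc => (abs_le.1 (abs_le_of_mem_valueCorr hM hc)).2⟩
      (apply_mem_valueCorr ha))

variable [TopologicalSpace A] [CompactSpace A]

theorem exists_forall_abs_le {uS : A → ℝ} (huS : Continuous uS) : ∃ M, ∀ a, |uS a| ≤ M := by
  obtain ⟨M, hM⟩ := isCompact_univ.exists_bound_of_continuousOn huS.continuousOn
  exact ⟨M, fun a => hM a (mem_univ a)⟩

theorem bestResponses_nonempty [Nonempty A] {uR : Ω → A → ℝ} (huR : ∀ ω, Continuous (uR ω))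
    (μ : Ω → ℝ) : (bestResponses uR μ).Nonempty := by
  obtain ⟨a, -, ha⟩ := isCompact_univ.exists_isMaxOn (univ_nonempty (α := A))
    (f := fun a => ∑ ω, μ ω * uR ω a)
    (Continuous.continuousOn (by fun_prop))
  exact ⟨a, fun a' => ha (mem_univ a')⟩

/-- The best-response graph is closed, and projection along the compact space `A` is a closed map.
-/
theorem isClosed_setOf_exists_bestResponse {uR : Ω → A → ℝ} (huR : ∀ ω, Continuous (uR ω))
    {S : Set A} (hS : IsClosed S) : IsClosed {μ : Ω → ℝ | ∃ a ∈ bestResponses uR μ, a ∈ S} := by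
  have hcl : IsClosed {q : (Ω → ℝ) × A | q.2 ∈ bestResponses uR q.1 ∧ q.2 ∈ S} := by
    refine IsClosed.inter ?_ (hS.preimage continuous_snd)
    have : {q : (Ω → ℝ) × A | q.2 ∈ bestResponses uR q.1} =
        ⋂ a', {q | ∑ ω, q.1 ω * uR ω a' ≤ ∑ ω, q.1 ω * uR ω q.2} := by
      ext q
      simp [bestResponses]
    change IsClosed {q : (Ω → ℝ) × A | q.2 ∈ bestResponses uR q.1}
    rw [this]
    exact isClosed_iInter fun a' => isClosed_le (by fun_prop) (by fun_prop)
  convert isClosedMap_fst_of_compactSpace _ hcl using 1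
  ext μ
  simp

/-- Intermediate values: on a segment along which the sender's value passes from at most `c` to at
least `c`, some belief has the value `c`. -/
theorem exists_mem_segment_mem_valueCorr [Nonempty A] {uS : A → ℝ} (huS : Continuous uS)
    {uR : Ω → A → ℝ} (huR : ∀ ω, Continuous (uR ω)) {x y : Ω → ℝ} {c : ℝ}
    (hx : ∃ a ∈ bestResponses uR x, uS a ≤ c) (hy : ∃ a ∈ bestResponses uR y, c ≤ uS a) :
    ∃ z ∈ segment ℝ x y, c ∈ valueCorr uS uR z := by
  -- The beliefs with a best response worth at most `c` and those with one worth at least `c` form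
  -- two closed sets covering the segment; connectedness makes them meet.
  obtain ⟨z, hz, h⟩ := isPreconnected_closed_iff.1 (convex_segment x y).isPreconnected _ _
    (isClosed_setOf_exists_bestResponse huR (isClosed_le huS (continuous_const (y := c))))
    (isClosed_setOf_exists_bestResponse huR (isClosed_le (continuous_const (y := c)) huS))
    (fun z _ => by
      obtain ⟨a, ha⟩ := bestResponses_nonempty huR z
      exact (le_total (uS a) c).imp (fun h => ⟨a, ha, h⟩) fun h => ⟨a, ha, h⟩)
    ⟨x, left_mem_segment ℝ x y, hx⟩ ⟨y, right_mem_segment ℝ x y, hy⟩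
  exact ⟨z, hz, mem_valueCorr_iff.2 h⟩

/-- The quasiconcave envelope of `𝐕` exceeds `s` exactly on the convex hull of the beliefs at which
some best response is worth more than `s` to the sender. -/
theorem lt_upperCT_iff [Nonempty A] {uS : A → ℝ} (huS : Continuous uS)
    {uR : Ω → A → ℝ} (huR : ∀ ω, Continuous (uR ω)) {ν : Ω → ℝ} (hν : ν ∈ stdSimplex ℝ Ω) {s : ℝ} :
    s < upperCT uS uR ν ↔
      ν ∈ convexHull ℝ {x ∈ stdSimplex ℝ Ω | ∃ a ∈ bestResponses uR x, s < uS a} := by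
  classical
  obtain ⟨M, hM⟩ := exists_forall_abs_le huS
  have hlt : ∀ {x r}, r < upperValue uS uR x ↔ ∃ a ∈ bestResponses uR x, r < uS a :=
    fun {x r} => lt_upperValue_iff hM (bestResponses_nonempty huR x)
  have hUM : ∀ x, upperValue uS uR x ≤ M := fun x => by
    by_contra! h
    obtain ⟨a, -, ha⟩ := hlt.1 h
    exact absurd (abs_le.1 (hM a)).2 ha.not_ge
  set D := {x ∈ stdSimplex ℝ Ω | ∃ a ∈ bestResponses uR x, s < uS a}
  have hbdd : BddBelow {y | ∃ f : (Ω → ℝ) → ℝ, QuasiconcaveOn ℝ (stdSimplex ℝ Ω) f ∧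
      (∀ ν ∈ stdSimplex ℝ Ω, upperValue uS uR ν ≤ f ν) ∧ y = f ν} :=
    ⟨upperValue uS uR ν, by rintro _ ⟨f, -, hf, rfl⟩; exact hf ν hν⟩
  constructor
  · intro h
    by_contra hn
    -- A two-valued competitor: `s` off the hull of `D` and `max s M` on it. Its superlevel sets are
    -- the simplex, its intersection with the hull, or empty.
    refine h.not_ge (csInf_le hbdd
      ⟨fun x => if x ∈ convexHull ℝ D then max s M else s, ?_, ?_, by simp [hn]⟩)
    · intro r
      by_cases hr : r ≤ s
      · convert convex_stdSimplex ℝ Ω using 1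
        ext x
        simp only [mem_ofPred_eq, and_iff_left_iff_imp]
        intro _
        split_ifs
        · exact hr.trans (le_max_left _ _)
        · exact hr
      · by_cases hr' : r ≤ max s M
        · convert (convex_stdSimplex ℝ Ω).inter (convex_convexHull ℝ D) using 1
          ext x
          by_cases hx : x ∈ convexHull ℝ D
          · simp [hx, le_max_iff.1 hr']
          · simp [hx, hr]
        · convert convex_empty (𝕜 := ℝ) (E := Ω → ℝ) using 1
          ext x
          simp only [mem_ofPred_eq, mem_empty_iff_false, iff_false, not_and]
          intro _
          split_ifs
          · exact hr'
          · exact hr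
    · intro x hx
      dsimp only
      split_ifs with hxD
      · exact (hUM x).trans (le_max_right _ _)
      · by_contra! h
        exact hxD (subset_convexHull ℝ D ⟨hx, hlt.1 h⟩)
  · intro h
    obtain ⟨ι, _, w, z, hw, hw1, hz, rfl⟩ := mem_convexHull_iff_exists_fintype.1 h
    have hne : Nonempty ι := by
      by_contra hι
      rw [not_nonempty_iff] at hι
      simp at hw1
    -- Finitely many points give a least upper value, still above `s`; every quasiconcave majorant
    -- is at least that large at the mixture, so the infimum stays strictly above `s`. The constant
    -- `M` shows that the infimum is over a nonempty set.
    obtain ⟨i₀, hi₀⟩ := Finite.exists_min fun i => upperValue uS uR (z i)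
    refine (hlt.2 (hz i₀).2).trans_le (le_csInf ⟨M, fun _ => M, ?_, fun x _ => hUM x, rfl⟩ ?_)
    · intro r
      by_cases hr : r ≤ M
      · simpa [hr] using convex_stdSimplex ℝ Ω
      · simpa [hr] using convex_empty (𝕜 := ℝ) (E := Ω → ℝ)
    · rintro _ ⟨f, hf, hfU, rfl⟩
      exact ((hf (upperValue uS uR (z i₀))).sum_mem (fun i _ => hw i) hw1 fun i _ =>
        ⟨(hz i).1, (hi₀ i).trans (hfU _ (hz i).1)⟩).2

/-- If a belief is a mixture of beliefs worth more than `s` to the sender, then it is a mixture of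
beliefs which all have one common value above `s`. -/
theorem exists_gt_mem_convexHull_valueCorr [Nonempty A] {uS : A → ℝ} (huS : Continuous uS)
    {uR : Ω → A → ℝ} (huR : ∀ ω, Continuous (uR ω)) {ν : Ω → ℝ} {s : ℝ}
    (hν : ν ∈ convexHull ℝ {x ∈ stdSimplex ℝ Ω | ∃ a ∈ bestResponses uR x, s < uS a}) :
    ∃ c > s, ν ∈ convexHull ℝ {x ∈ stdSimplex ℝ Ω | c ∈ valueCorr uS uR x} := by
  have hνΔ : ν ∈ stdSimplex ℝ Ω :=
    convexHull_min (fun x hx => hx.1) (convex_stdSimplex ℝ Ω) hν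
  by_cases hex : ∃ a ∈ bestResponses uR ν, s < uS a
  · obtain ⟨a, ha, hsa⟩ := hex
    exact ⟨uS a, hsa, subset_convexHull ℝ _ ⟨hνΔ, apply_mem_valueCorr ha⟩⟩
  push Not at hex
  obtain ⟨ι, _, w, z, hw, hw1, hz, hzν⟩ := mem_convexHull_iff_exists_fintype.1 hν
  have hne : Nonempty ι := by
    by_contra hι
    rw [not_nonempty_iff] at hι
    simp at hw1
  choose hzΔ a ha hsa using hz
  obtain ⟨i₀, hi₀⟩ := Finite.exists_min fun i => uS (a i)
  obtain ⟨b, hb⟩ := bestResponses_nonempty huR ν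
  -- All best responses at `ν` are now worth at most `s`, so on the way to each `z i` the value
  -- crosses the smallest level `uS (a i₀)`.
  have hseg : ∀ i, ∃ y ∈ segment ℝ ν (z i), uS (a i₀) ∈ valueCorr uS uR y := fun i =>
    exists_mem_segment_mem_valueCorr huS huR ⟨b, hb, (hex b hb).trans (hsa i₀).le⟩
      ⟨a i, ha i, hi₀ i⟩
  choose y hy hyc using hseg
  exact ⟨uS (a i₀), hsa i₀, mem_convexHull_of_segments w z y hw hw1 hzν hy fun i =>
    ⟨(convex_stdSimplex ℝ Ω).segment_subset hνΔ (hzΔ i) (hy i), hyc i⟩⟩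

end Correspondence

/-! ### Passing to `-uS` exchanges the two envelopes. -/

section Reflection

variable {Ω A : Type*} [Fintype Ω]

theorem mem_valueCorr_neg {uS : A → ℝ} {uR : Ω → A → ℝ} {μ : Ω → ℝ} {c : ℝ} :
    c ∈ valueCorr (-uS) uR μ ↔ -c ∈ valueCorr uS uR μ := by
  simp only [mem_valueCorr_iff, Pi.neg_apply, neg_le, le_neg, and_comm]

theorem upperValue_neg {uS : A → ℝ} {uR : Ω → A → ℝ} {μ : Ω → ℝ} :
    upperValue (-uS) uR μ = -lowerValue uS uR μ := by
  have : valueCorr (-uS) uR μ = -valueCorr uS uR μ := by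
    ext c
    exact mem_valueCorr_neg
  rw [upperValue, lowerValue, this, Real.sSup_neg]

theorem upperCT_neg {uS : A → ℝ} {uR : Ω → A → ℝ} {μ : Ω → ℝ} :
    upperCT (-uS) uR μ = -lowerCT uS uR μ := by
  rw [upperCT, lowerCT, ← Real.sInf_neg]
  congr 1
  ext y
  simp only [Set.mem_neg, mem_ofPred_eq, upperValue_neg]
  constructor
  · rintro ⟨f, hf, hfU, rfl⟩
    exact ⟨-f, fun r => by simpa [neg_le] using hf (-r), fun ν hν => by
      have := hfU ν hν
      simp only [Pi.neg_apply]; linarith, rfl⟩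
  · rintro ⟨f, hf, hfU, hy⟩
    exact ⟨-f, fun r => by simpa [le_neg] using hf (-r), fun ν hν => by
      have := hfU ν hν
      simp only [Pi.neg_apply]; linarith, by simp [← hy]⟩

variable [TopologicalSpace A] [CompactSpace A] [Nonempty A]

theorem lowerCT_lt_iff {uS : A → ℝ} (huS : Continuous uS)
    {uR : Ω → A → ℝ} (huR : ∀ ω, Continuous (uR ω)) {ν : Ω → ℝ} (hν : ν ∈ stdSimplex ℝ Ω) {s : ℝ} :
    lowerCT uS uR ν < s ↔
      ν ∈ convexHull ℝ {x ∈ stdSimplex ℝ Ω | ∃ a ∈ bestResponses uR x, uS a < s} := by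
  have := lt_upperCT_iff (uS := -uS) huS.neg huR hν (s := -s)
  simpa only [upperCT_neg, Pi.neg_apply, neg_lt_neg_iff] using this

theorem exists_lt_mem_convexHull_valueCorr {uS : A → ℝ} (huS : Continuous uS)
    {uR : Ω → A → ℝ} (huR : ∀ ω, Continuous (uR ω)) {ν : Ω → ℝ} {s : ℝ}
    (hν : ν ∈ convexHull ℝ {x ∈ stdSimplex ℝ Ω | ∃ a ∈ bestResponses uR x, uS a < s}) :
    ∃ c < s, ν ∈ convexHull ℝ {x ∈ stdSimplex ℝ Ω | c ∈ valueCorr uS uR x} := by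
  obtain ⟨c, hc, h⟩ := exists_gt_mem_convexHull_valueCorr (uS := -uS) huS.neg huR (ν := ν) (s := -s)
    (by simpa only [Pi.neg_apply, neg_lt_neg_iff] using hν)
  exact ⟨-c, by linarith, by simpa only [mem_valueCorr_neg] using h⟩

end Reflection

/-! ### Finite mediation plans as points of a convex hull. -/

section Feasible

variable {Ω A : Type*} [Fintype Ω]

/-- Values assigned to finitely many weighted beliefs, with possible repetitions, can be averaged to
a single measurable selection with the same weighted sums. -/
theorem exists_isSelection_sum_eq {uS : A → ℝ} {uR : Ω → A → ℝ} {V₀ : stdSimplex ℝ Ω → ℝ}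
    (hV₀ : IsSelection uS uR V₀) {ι : Type*} [Fintype ι] {m : ι → ℝ} (hm : ∀ i, 0 ≤ m i)
    {z : ι → stdSimplex ℝ Ω} {v : ι → ℝ} (hv : ∀ i, v i ∈ valueCorr uS uR (z i : Ω → ℝ)) :
    ∃ V, IsSelection uS uR V ∧ ∀ g : stdSimplex ℝ Ω → ℝ,
      ∑ i, m i * (V (z i) * g (z i)) = ∑ i, m i * (v i * g (z i)) := by
  classical
  let F : stdSimplex ℝ Ω → Finset ι := fun ν => Finset.univ.filter fun i => z i = ν
  -- At a belief carrying mass, the mass-weighted average of its assigned values stays in `𝐕` by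
  -- convexity. Elsewhere `V₀` is kept, so only finitely many values change and measurability
  -- survives.
  let V : stdSimplex ℝ Ω → ℝ := fun ν =>
    if ∑ i ∈ F ν, m i = 0 then V₀ ν else (F ν).centerMass m v
  have hVF : ∀ ν, (∑ i ∈ F ν, m i) * V ν = ∑ i ∈ F ν, m i * v i := by
    intro ν
    by_cases h : ∑ i ∈ F ν, m i = 0
    · rw [h, zero_mul]
      have := (Finset.sum_eq_zero_iff_of_nonneg fun i _ => hm i).1 h
      exact (Finset.sum_eq_zero fun i hi => by rw [this i hi, zero_mul]).symm
    · simp only [V, if_neg h, Finset.centerMass, smul_eq_mul]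
      rw [mul_inv_cancel_left₀ h]
  refine ⟨V, ⟨hV₀.1.measurable_of_countable_ne
    (((Set.finite_range z).subset ?_).countable), fun ν => ?_⟩, fun g => ?_⟩
  · intro ν hν
    by_contra hr
    refine hν ?_
    have : F ν = ∅ := Finset.filter_eq_empty_iff.2 fun i _ hi => hr ⟨i, hi⟩
    simp [V, this]
  · by_cases h : ∑ i ∈ F ν, m i = 0
    · simpa only [V, if_pos h] using hV₀.2 ν
    · simp only [V, if_neg h]
      refine (convex_convexHull ℝ _).centerMass_mem (fun i _ => hm i)
        (lt_of_le_of_ne (Finset.sum_nonneg fun i _ => hm i) (Ne.symm h)) fun i hi => ?_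
      have := hv i
      rwa [(Finset.mem_filter.1 hi).2] at this
  · have hmaps : ∀ i ∈ (Finset.univ : Finset ι), z i ∈ Finset.univ.image z :=
      fun i _ => Finset.mem_image_of_mem z (Finset.mem_univ i)
    rw [← Finset.sum_fiberwise_of_maps_to hmaps, ← Finset.sum_fiberwise_of_maps_to hmaps]
    refine Finset.sum_congr rfl fun ν _ => ?_
    calc ∑ i ∈ F ν, m i * (V (z i) * g (z i)) = ∑ i ∈ F ν, m i * (V ν * g ν) :=
          Finset.sum_congr rfl fun i hi => by rw [(Finset.mem_filter.1 hi).2]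
      _ = (∑ i ∈ F ν, m i * v i) * g ν := by rw [← Finset.sum_mul, ← mul_assoc, hVF]
      _ = ∑ i ∈ F ν, m i * (v i * g (z i)) := by
          rw [Finset.sum_mul]
          exact Finset.sum_congr rfl fun i hi => by rw [(Finset.mem_filter.1 hi).2, mul_assoc]

theorem exists_probabilityMeasure_integral_eq_sum {X : Type*} [MeasurableSpace X]
    [MeasurableSingletonClass X] {ι : Type*} [Fintype ι] {m : ι → ℝ} (hm : ∀ i, 0 ≤ m i)
    (hm1 : ∑ i, m i = 1) (z : ι → X) :
    ∃ τ : ProbabilityMeasure X, ∀ F : X → ℝ, ∫ x, F x ∂(τ : Measure X) = ∑ i, m i * F (z i) := by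
  refine ⟨⟨∑ i, ENNReal.ofReal (m i) • Measure.dirac (z i), ⟨?_⟩⟩, fun F => ?_⟩
  · simp only [Measure.coe_finsetSum, Finset.sum_apply, Measure.smul_apply, measure_univ,
      smul_eq_mul, mul_one]
    rw [← ENNReal.ofReal_sum_of_nonneg fun i _ => hm i, hm1, ENNReal.ofReal_one]
  · rw [ProbabilityMeasure.coe_mk, integral_finsetSum_measure]
    · exact Finset.sum_congr rfl fun i _ => by
        rw [integral_smul_measure, integral_dirac, ENNReal.toReal_ofReal (hm i), smul_eq_mul]
    · exact fun i _ => (integrable_dirac (by simp)).smul_measure ENNReal.ofReal_ne_top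

/-- The triples `(z, c, c • (z - p))` with `c ∈ 𝐕(z)`, recording a belief, a value at it and the
resulting contribution to the truth-telling constraint. -/
def outcomeSet (uS : A → ℝ) (uR : Ω → A → ℝ) (p : Ω → ℝ) : Set ((Ω → ℝ) × ℝ × (Ω → ℝ)) :=
  {g | g.1 ∈ stdSimplex ℝ Ω ∧ g.2.1 ∈ valueCorr uS uR g.1 ∧ g.2.2 = g.2.1 • (g.1 - p)}

/-- The three coordinates encode Bayes plausibility, the payoff and truth-telling, so building a
plan reduces to convex arithmetic. -/
theorem exists_mediationFeasible {uS : A → ℝ} {uR : Ω → A → ℝ} {V₀ : stdSimplex ℝ Ω → ℝ}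
    (hV₀ : IsSelection uS uR V₀) {p : Ω → ℝ} {v : ℝ}
    (h : (p, v, (0 : Ω → ℝ)) ∈ convexHull ℝ (outcomeSet uS uR p)) :
    ∃ τ V, MediationFeasible uS uR p τ V ∧ v = ∫ μ, V μ ∂(τ : Measure (stdSimplex ℝ Ω)) := by
  obtain ⟨ι, _, m, g, hm, hm1, hg, hsum⟩ := mem_convexHull_iff_exists_fintype.1 h
  choose hgΔ hgv hgp using hg
  obtain ⟨V, hV, hVm⟩ := exists_isSelection_sum_eq hV₀ hm (z := fun i => ⟨(g i).1, hgΔ i⟩) hgv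
  obtain ⟨τ, hτ⟩ := exists_probabilityMeasure_integral_eq_sum hm hm1
    fun i => (⟨(g i).1, hgΔ i⟩ : stdSimplex ℝ Ω)
  simp only [Prod.ext_iff, Prod.fst_sum, Prod.snd_sum, Prod.smul_fst, Prod.smul_snd] at hsum
  obtain ⟨h1, h2, h3⟩ := hsum
  refine ⟨τ, V, ⟨hV, fun ω => ?_, fun ω => ?_⟩, ?_⟩
  · rw [hτ]
    have h1' := congrFun h1 ω
    rw [Finset.sum_apply] at h1'
    exact h1'
  · rw [hτ]
    refine (hVm fun ν => (ν : Ω → ℝ) ω - p ω).trans ?_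
    have h3' := congrFun h3 ω
    rw [Finset.sum_apply] at h3'
    refine (Finset.sum_congr rfl fun i _ => ?_).trans h3'
    simp only [hgp i, Pi.smul_apply, Pi.sub_apply, smul_eq_mul]
    rfl
  · rw [hτ, ← h2]
    have := hVm fun _ => 1
    simpa using this.symm

/-- For a fixed value `c` the truth-telling term is affine in the belief. Hence a mixture of beliefs
sharing the value `c` counts as one belief of value `c`, which is why common values are sought. -/
theorem mem_convexHull_outcomeSet {uS : A → ℝ} {uR : Ω → A → ℝ} (p : Ω → ℝ) {q : Ω → ℝ} {c : ℝ}
    (hq : q ∈ convexHull ℝ {x ∈ stdSimplex ℝ Ω | c ∈ valueCorr uS uR x}) :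
    (q, c, c • (q - p)) ∈ convexHull ℝ (outcomeSet uS uR p) := by
  let φ : (Ω → ℝ) →ᵃ[ℝ] (Ω → ℝ) × ℝ × (Ω → ℝ) :=
    (AffineMap.id ℝ _).prod ((AffineMap.const ℝ _ c).prod
      (c • (AffineMap.id ℝ _ - AffineMap.const ℝ _ p)))
  have hsub : {x ∈ stdSimplex ℝ Ω | c ∈ valueCorr uS uR x} ⊆
      φ ⁻¹' convexHull ℝ (outcomeSet uS uR p) := fun x hx =>
    subset_convexHull ℝ _ (show φ x ∈ outcomeSet uS uR p from ⟨hx.1, hx.2, rfl⟩)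
  exact convexHull_min hsub ((convex_convexHull ℝ _).affine_preimage φ) hq

theorem bddAbove_mediationValues {uS : A → ℝ} {uR : Ω → A → ℝ} {M : ℝ} (hM : ∀ a, |uS a| ≤ M)
    (p : Ω → ℝ) : BddAbove {v | ∃ (τ : ProbabilityMeasure (stdSimplex ℝ Ω))
      (V : stdSimplex ℝ Ω → ℝ), MediationFeasible uS uR p τ V ∧
        v = ∫ μ, V μ ∂(τ : Measure (stdSimplex ℝ Ω))} := by
  refine ⟨M, ?_⟩
  rintro _ ⟨τ, V, hV, rfl⟩
  have hb : ∀ μ, ‖V μ‖ ≤ M := fun μ => abs_le_of_mem_valueCorr hM (hV.1.2 μ)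
  have := norm_integral_le_of_norm_le_const (μ := (τ : Measure (stdSimplex ℝ Ω)))
    (Eventually.of_forall hb)
  simp only [probReal_univ, mul_one] at this
  exact (le_abs_self _).trans this

/-- A Bayes-plausible distribution of finite support is a convex combination with positive
weights. -/
theorem exists_weights_of_finite_supp {p : Ω → ℝ} {τ : ProbabilityMeasure (stdSimplex ℝ Ω)}
    (hτ : τ ∈ bayesPlausible p) (hfin : (supp τ).Finite) [Fintype (supp τ)] :
    ∃ w : supp τ → ℝ, (∀ i, 0 < w i) ∧ ∑ i, w i = 1 ∧
      ∑ i, w i • ((i : stdSimplex ℝ Ω) : Ω → ℝ) = p := by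
  have hres : (τ : Measure (stdSimplex ℝ Ω)).restrict (hfin.toFinset : Set _) = τ := by
    rw [hfin.coe_toFinset]
    exact Measure.restrict_eq_self_of_ae_mem Measure.support_mem_ae
  have hint : ∀ F : stdSimplex ℝ Ω → ℝ, ∫ x, F x ∂(τ : Measure (stdSimplex ℝ Ω)) =
      ∑ i : supp τ, (τ : Measure (stdSimplex ℝ Ω)).real {(i : stdSimplex ℝ Ω)} * F i := by
    intro F
    conv_lhs => rw [← hres]
    rw [setIntegral_finset hfin.toFinset IntegrableOn.finset]
    simp only [smul_eq_mul]
    exact (Finset.sum_subtype _ (fun x => hfin.mem_toFinset) _)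
  refine ⟨fun i => (τ : Measure (stdSimplex ℝ Ω)).real {(i : stdSimplex ℝ Ω)}, fun i => ?_, ?_, ?_⟩
  -- Removing the other, finitely many, support points leaves a neighbourhood of `i` whose mass sits
  -- entirely at `i`.
  · have hopen : ((supp τ \ {(i : stdSimplex ℝ Ω)})ᶜ) ∈ 𝓝 (i : stdSimplex ℝ Ω) :=
      (hfin.subset sdiff_subset).isClosed.isOpen_compl.mem_nhds (by simp)
    have hpos := (Measure.mem_support_iff_forall _).1 i.2 _ hopen
    rw [← measure_inter_conull (t := supp τ) Measure.measure_compl_support] at hpos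
    refine ENNReal.toReal_pos (ne_of_gt (hpos.trans_le (measure_mono ?_))) (measure_ne_top _ _)
    rintro x ⟨hx, hxs⟩
    by_contra hne
    exact hx ⟨hxs, hne⟩
  · simpa using (hint fun _ => 1).symm
  · ext ω
    rw [← hτ ω, hint]
    simp

end Feasible

theorem abs_apply_le_one {Ω : Type*} [Fintype Ω] (μ : stdSimplex ℝ Ω) (ω : Ω) :
    |(μ : Ω → ℝ) ω| ≤ 1 := by
  have h0 : ∀ i, 0 ≤ μ.1 i := μ.2.1
  have h1 : μ.1 ω ≤ ∑ i, μ.1 i := Finset.single_le_sum (fun i _ => h0 i) (Finset.mem_univ ω)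
  exact abs_le.2 ⟨neg_one_lt_zero.le.trans (h0 ω), h1.trans_eq μ.2.2⟩

/-! ### Local improvability yields a better mediation plan. -/

section Improvement

variable {Ω A : Type*} [Fintype Ω]

/-- Combining beliefs worth more than `s`, beliefs worth less than `s` and the finitely supported
distribution attaining `s` improves on `s` under mediation. -/
theorem exists_mediationFeasible_gt {uS : A → ℝ} {uR : Ω → A → ℝ} {p : Ω → ℝ} {s : ℝ}
    {τ : ProbabilityMeasure (stdSimplex ℝ Ω)} (hτ : AttainsCT uS uR p τ s)
    (hfin : (supp τ).Finite) {μ : Ω → ℝ}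
    (hμ : μ ∈ affineSpan ℝ ((fun ν : stdSimplex ℝ Ω => (ν : Ω → ℝ)) '' supp τ)) {t : ℝ}
    (ht : t ∈ Ico (0 : ℝ) 1) {c₁ c₂ : ℝ} (hc₁ : s < c₁) (hc₂ : c₂ < s)
    (hx : t • μ + (1 - t) • p ∈ convexHull ℝ {x ∈ stdSimplex ℝ Ω | c₁ ∈ valueCorr uS uR x})
    (hy : μ ∈ convexHull ℝ {x ∈ stdSimplex ℝ Ω | c₂ ∈ valueCorr uS uR x}) :
    ∃ v > s, ∃ τ' V, MediationFeasible uS uR p τ' V ∧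
      v = ∫ ν, V ν ∂(τ' : Measure (stdSimplex ℝ Ω)) := by
  classical
  have := hfin.fintype
  obtain ⟨⟨hbp, V₀, hV₀, -⟩, hsupp⟩ := hτ
  obtain ⟨w, hw, hw1, hwp⟩ := exists_weights_of_finite_supp hbp hfin
  rw [image_eq_range] at hμ
  obtain ⟨δ, hδ, hmem⟩ := exists_sub_smul_mem_convexHull hw hw1 hμ
  rw [hwp] at hmem
  have hsub : range (fun i : supp τ => ((i : stdSimplex ℝ Ω) : Ω → ℝ)) ⊆
      {x ∈ stdSimplex ℝ Ω | s ∈ valueCorr uS uR x} := by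
    rintro _ ⟨i, rfl⟩
    exact ⟨i.1.2, hsupp i.1 i.2⟩
  set C := convexHull ℝ {x ∈ stdSimplex ℝ Ω | s ∈ valueCorr uS uR x}
  have hCc : Convex ℝ C := convex_convexHull ℝ _
  have hmemC : p - δ • (μ - p) ∈ C := convexHull_mono hsub hmem
  have hpC : p ∈ C := by
    rw [← hwp]
    exact hCc.sum_mem (fun i _ => (hw i).le) hw1 fun i _ =>
      subset_convexHull ℝ _ (hsub (mem_range_self i))
  have h1 : 0 < c₁ - s := sub_pos.2 hc₁
  have h2 : 0 < s - c₂ := sub_pos.2 hc₂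
  -- Weights `κ A₁` at value `c₁` and `κ B₁` at value `c₂` contribute `κ` and `-κ t` to the integral
  -- of `V - s`. Truth-telling balances because the first mean differs from `p` by `t (μ - p)`, and
  -- the gain is `κ (1 - t)`.
  obtain ⟨A₁, hA₁⟩ : ∃ A₁, A₁ = (c₁ - s)⁻¹ := ⟨_, rfl⟩
  obtain ⟨B₁, hB₁⟩ : ∃ B₁, B₁ = t / (s - c₂) := ⟨_, rfl⟩
  have hA : 0 < A₁ := hA₁ ▸ inv_pos.2 h1
  have hB : 0 ≤ B₁ := hB₁ ▸ div_nonneg ht.1 h2.le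
  have hAc : A₁ * (c₁ - s) = 1 := by rw [hA₁, inv_mul_cancel₀ h1.ne']
  have hBc : B₁ * (s - c₂) = t := by rw [hB₁, div_mul_cancel₀ _ h2.ne']
  have hN : 0 < A₁ + B₁ := by linarith
  obtain ⟨κ, hκ, hκ1, hκδ⟩ : ∃ κ > 0, κ * (A₁ + B₁) ≤ 1 / 2 ∧ κ * (A₁ + B₁) ≤ δ / 2 := by
    refine ⟨min (1 / 2) (δ / 2) / (A₁ + B₁), div_pos (lt_min (by norm_num) (by linarith)) hN, ?_⟩
    rw [div_mul_cancel₀ _ hN.ne']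
    exact ⟨min_le_left _ _, min_le_right _ _⟩
  obtain ⟨γ, hγ⟩ : ∃ γ, γ = 1 - κ * A₁ - κ * B₁ := ⟨_, rfl⟩
  have hγ2 : 1 / 2 ≤ γ := by rw [hγ]; linarith
  -- The remaining mass `γ` must have mean `p - ε (μ - p)` to restore the prior. Since `γ ≥ 1/2` and
  -- `κ (A₁ + B₁) ≤ δ / 2`, `ε ≤ δ`, so this mean lies in `C`.
  obtain ⟨ε, hε⟩ : ∃ ε, ε = (κ * A₁ * t + κ * B₁) / γ := ⟨_, rfl⟩
  have hγε : γ * ε = κ * A₁ * t + κ * B₁ := by rw [hε, mul_div_cancel₀ _ (by linarith)]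
  have hκA : 0 < κ * A₁ := mul_pos hκ hA
  have hκB : 0 ≤ κ * B₁ := mul_nonneg hκ.le hB
  have hε0 : 0 ≤ ε := hε ▸ div_nonneg (add_nonneg (mul_nonneg hκA.le ht.1) hκB) (by linarith)
  have hεδ : ε ≤ δ := by
    rw [hε, div_le_iff₀ (by linarith)]
    nlinarith [mul_le_of_le_one_right hκA.le ht.2.le]
  have hr : p - ε • (μ - p) ∈ C := by
    have := hCc hpC hmemC (a := 1 - ε / δ) (b := ε / δ)
      (sub_nonneg.2 ((div_le_one hδ).2 hεδ)) (div_nonneg hε0 hδ.le) (by ring)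
    convert this using 1
    ext ω
    simp only [Pi.sub_apply, Pi.add_apply, Pi.smul_apply, smul_eq_mul]
    field_simp
    ring
  have hcomb := (convex_convexHull ℝ (outcomeSet uS uR p)).sum_mem (t := Finset.univ)
    (w := ![κ * A₁, κ * B₁, γ])
    (z := ![(t • μ + (1 - t) • p, c₁, c₁ • (t • μ + (1 - t) • p - p)), (μ, c₂, c₂ • (μ - p)),
      (p - ε • (μ - p), s, s • (p - ε • (μ - p) - p))]) ?_ ?_ ?_
  · refine ⟨s + κ * (1 - t), by nlinarith [ht.2, mul_pos hκ (sub_pos.2 ht.2)],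
      exists_mediationFeasible hV₀ ?_⟩
    convert hcomb using 1
    simp only [Fin.sum_univ_three, Matrix.cons_val]
    refine Prod.ext ?_ (Prod.ext ?_ ?_)
    · ext ω
      simp
      linear_combination (-(p ω)) * hγ + (μ ω - p ω) * hγε
    · simp
      linear_combination (-s) * hγ - κ * hAc + κ * hBc
    · ext ω
      simp
      linear_combination (s * (μ ω - p ω)) * hγε - κ * t * (μ ω - p ω) * hAc
        + κ * (μ ω - p ω) * hBc
  · intro i _
    fin_cases i
    · exact hκA.le
    · exact hκB
    · exact (by linarith : (0 : ℝ) ≤ γ)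
  · simp [Fin.sum_univ_three, hγ]
  · intro i _
    fin_cases i
    · exact mem_convexHull_outcomeSet p hx
    · exact mem_convexHull_outcomeSet p hy
    · exact mem_convexHull_outcomeSet p hr

end Improvement

/-! ### Without improvability, mediation yields at most `s`. -/

section UpperBound

variable {Ω A : Type*} [Fintype Ω] [TopologicalSpace A] [CompactSpace A] [Nonempty A]

/-- Unless `s` is improvable, or the prior itself is a mixture of beliefs worth more than `s`, no
mediation plan yields more than `s`. -/
theorem integral_le_of_not_improvable {uS : A → ℝ} (huS : Continuous uS)
    {uR : Ω → A → ℝ} (huR : ∀ ω, Continuous (uR ω)) {p : Ω → ℝ} (hp : p ∈ stdSimplex ℝ Ω) {s : ℝ}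
    (himp : ¬ Improvable uS uR p s)
    (hdeg : (∀ μ ∈ stdSimplex ℝ Ω, s ≤ lowerCT uS uR μ) → upperCT uS uR p ≤ s)
    {τ : ProbabilityMeasure (stdSimplex ℝ Ω)} {V : stdSimplex ℝ Ω → ℝ}
    (hV : MediationFeasible uS uR p τ V) :
    ∫ μ, V μ ∂(τ : Measure (stdSimplex ℝ Ω)) ≤ s := by
  obtain ⟨M, hM⟩ := exists_forall_abs_le huS
  obtain ⟨⟨hVm, hVc⟩, hbp, htruth⟩ := hV
  set m := (τ : Measure (stdSimplex ℝ Ω))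
  have hVi : Integrable V m := Integrable.of_bound hVm.aestronglyMeasurable M
    (Eventually.of_forall fun μ => abs_le_of_mem_valueCorr hM (hVc μ))
  have hWi : Integrable (fun μ => V μ - s) m := hVi.sub (integrable_const s)
  have hfm : Measurable fun μ : stdSimplex ℝ Ω => (μ : Ω → ℝ) := measurable_subtype_coe
  have hfb : ∀ᵐ μ : stdSimplex ℝ Ω ∂m, ‖(μ : Ω → ℝ)‖ ≤ 1 := Eventually.of_forall fun μ =>
    (pi_norm_le_iff_of_nonneg zero_le_one).2 (abs_apply_le_one μ)
  have hsmul : ∀ {w : stdSimplex ℝ Ω → ℝ}, Integrable w m →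
      Integrable (fun μ => w μ • (μ : Ω → ℝ)) m := fun hw =>
    hw.smul_bdd 1 hfm.aestronglyMeasurable hfb
  have hcoord : ∀ ω, Integrable (fun μ : stdSimplex ℝ Ω => (μ : Ω → ℝ) ω) m := fun ω =>
    ((integrable_const (1 : ℝ)).mono' ((measurable_pi_apply ω).comp hfm).aestronglyMeasurable
      (hfb.mono fun μ hμ => (norm_le_pi_norm _ ω).trans hμ))
  -- Truth-telling and Bayes plausibility together: the signed weight `V - s` has its first moment
  -- along `p`.
  have hmean : ∫ μ, (V μ - s) • (μ : Ω → ℝ) ∂m = (∫ μ, (V μ - s) ∂m) • p := by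
    ext ω
    rw [eval_integral fun ω => (hsmul hWi).eval ω]
    have hVω : Integrable (fun μ : stdSimplex ℝ Ω => V μ * (μ : Ω → ℝ) ω) m := (hsmul hVi).eval ω
    have ht := htruth ω
    simp only [mul_sub] at ht
    rw [integral_sub hVω (hVi.mul_const _), integral_mul_const] at ht
    simp only [Pi.smul_apply, smul_eq_mul, sub_mul]
    rw [integral_sub hVω ((hcoord ω).const_mul s), integral_const_mul, hbp ω,
      integral_sub hVi (integrable_const s)]
    simp only [integral_const, probReal_univ, smul_eq_mul]
    linarith
  by_contra! hlt
  let wp : stdSimplex ℝ Ω → ℝ := fun μ => max (V μ - s) 0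
  let wn : stdSimplex ℝ Ω → ℝ := fun μ => max (-(V μ - s)) 0
  have hpn : ∀ μ, V μ - s = wp μ - wn μ := fun μ =>
    (max_zero_sub_max_neg_zero_eq_self (V μ - s)).symm
  have hwpi : Integrable wp m := hWi.pos_part
  have hwni : Integrable wn m := hWi.neg_part
  have hwp0 : ∀ μ, 0 ≤ wp μ := fun μ => le_max_right _ _
  have hwn0 : ∀ μ, 0 ≤ wn μ := fun μ => le_max_right _ _
  have hdiff : ∫ μ, (V μ - s) ∂m = ∫ μ, wp μ ∂m - ∫ μ, wn μ ∂m := by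
    simp only [hpn]
    exact integral_sub hwpi hwni
  have hdiff0 : 0 < ∫ μ, (V μ - s) ∂m := by
    rw [integral_sub hVi (integrable_const s)]
    simpa using hlt
  have hvec : ∫ μ, wp μ • (μ : Ω → ℝ) ∂m - ∫ μ, wn μ • (μ : Ω → ℝ) ∂m =
      (∫ μ, wp μ ∂m) • p - (∫ μ, wn μ ∂m) • p := by
    rw [← sub_smul, ← hdiff, ← hmean, ← integral_sub (hsmul hwpi) (hsmul hwni)]
    simp only [hpn, sub_smul]
  have hwn_nonneg : 0 ≤ ∫ μ, wn μ ∂m := integral_nonneg hwn0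
  have hwp_pos : 0 < ∫ μ, wp μ ∂m := by linarith
  have hx := inv_smul_integral_mem hwp0 hwpi hwp_pos
    (convex_convexHull ℝ {x ∈ stdSimplex ℝ Ω | ∃ a ∈ bestResponses uR x, s < uS a})
    (f := fun μ : stdSimplex ℝ Ω => (μ : Ω → ℝ)) (fun μ hμ => by
      obtain ⟨-, a, ha, hVa⟩ := mem_valueCorr_iff.1 (hVc μ)
      have : s < V μ := by simpa [wp] using hμ
      exact subset_convexHull ℝ _ ⟨μ.2, a, ha, this.trans_le hVa⟩) (hsmul hwpi)
  rcases hwn_nonneg.eq_or_lt with hzero | hwn_pos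
  -- No mass below `s`: the barycenter of the positive part is `p` itself. Any belief with lower
  -- envelope below `s` then gives improvability with `t = 0`; otherwise the degenerate clause
  -- applies.
  · have hwn : wn =ᵐ[m] 0 := (integral_eq_zero_iff_of_nonneg hwn0 hwni).1 hzero.symm
    have hN : ∫ μ, wn μ • (μ : Ω → ℝ) ∂m = 0 := by
      rw [integral_congr_ae (hwn.mono fun μ hμ => by
        rw [hμ, Pi.zero_apply, zero_smul]), integral_zero]
    rw [hN, ← hzero, zero_smul, sub_zero, sub_zero] at hvec
    rw [hvec, inv_smul_smul₀ hwp_pos.ne', ← lt_upperCT_iff huS huR hp] at hx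
    by_cases h : ∀ μ ∈ stdSimplex ℝ Ω, s ≤ lowerCT uS uR μ
    · exact hx.not_ge (hdeg h)
    · push Not at h
      obtain ⟨μ, hμ, hμs⟩ := h
      exact himp ⟨μ, hμ, 0, ⟨le_rfl, one_pos⟩, by simpa using hx, hμs⟩
  · have hy := inv_smul_integral_mem hwn0 hwni hwn_pos
      (convex_convexHull ℝ {x ∈ stdSimplex ℝ Ω | ∃ a ∈ bestResponses uR x, uS a < s})
      (f := fun μ : stdSimplex ℝ Ω => (μ : Ω → ℝ)) (fun μ hμ => by
        obtain ⟨⟨a, ha, hVa⟩, -⟩ := mem_valueCorr_iff.1 (hVc μ)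
        have : V μ < s := by simpa [wn] using hμ
        exact subset_convexHull ℝ _ ⟨μ.2, a, ha, hVa.trans_lt this⟩) (hsmul hwni)
    have hΔ : ∀ {P : (Ω → ℝ) → Prop} {y}, y ∈ convexHull ℝ {x ∈ stdSimplex ℝ Ω | P x} →
        y ∈ stdSimplex ℝ Ω := fun h =>
      convexHull_min (fun x hx => hx.1) (convex_stdSimplex ℝ Ω) h
    set α := ∫ μ, wp μ ∂m
    set β := ∫ μ, wn μ ∂m
    -- Dividing the moment identity by `α` puts the upper barycenter between `p` and the lower one,
    -- with `t = β / α < 1`.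
    have hline : α⁻¹ • ∫ μ, wp μ • (μ : Ω → ℝ) ∂m =
        (β / α) • (β⁻¹ • ∫ μ, wn μ • (μ : Ω → ℝ) ∂m) + (1 - β / α) • p := by
      have e : ∫ μ, wp μ • (μ : Ω → ℝ) ∂m =
          ∫ μ, wn μ • (μ : Ω → ℝ) ∂m + (α • p - β • p) := by
        rw [← hvec]; abel
      rw [e]
      ext ω
      simp only [Pi.smul_apply, Pi.add_apply, Pi.sub_apply, smul_eq_mul]
      field_simp
    have hxΔ := hΔ hx
    rw [← lt_upperCT_iff huS huR hxΔ, hline] at hx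
    exact himp ⟨_, hΔ hy, β / α, ⟨div_nonneg hwn_nonneg hwp_pos.le,
      (div_lt_one hwp_pos).2 (by linarith)⟩, hx, (lowerCT_lt_iff huS huR (hΔ hy)).2 hy⟩

end UpperBound

/-- A cheap talk value is a mediation value. -/
theorem exists_mediationFeasible_of_attainableCT {Ω A : Type*} [Fintype Ω] {uS : A → ℝ}
    {uR : Ω → A → ℝ} {p : Ω → ℝ} {s : ℝ} (h : AttainableCT uS uR p s) :
    ∃ τ V, MediationFeasible uS uR p τ V ∧ s = ∫ ν, V ν ∂(τ : Measure (stdSimplex ℝ Ω)) := by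
  classical
  obtain ⟨τ, ⟨hbp, V₀, hV₀, -⟩, hsupp⟩ := h
  -- The given selection may be constant at a value other than `s`, so it is overwritten by `s` on
  -- the closed support. Truth-telling then follows from Bayes plausibility.
  let V : stdSimplex ℝ Ω → ℝ := fun ν => if ν ∈ supp τ then s else V₀ ν
  have hVs : ∀ᵐ ν ∂(τ : Measure (stdSimplex ℝ Ω)), V ν = s :=
    mem_of_superset Measure.support_mem_ae fun ν hν => if_pos hν
  refine ⟨τ, V, ⟨⟨?_, fun ν => ?_⟩, hbp, fun ω => ?_⟩, ?_⟩
  · exact Measurable.ite Measure.isClosed_support.measurableSet measurable_const hV₀.1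
  · by_cases hν : ν ∈ supp τ
    · simpa only [V, if_pos hν] using hsupp ν hν
    · simpa only [V, if_neg hν] using hV₀.2 ν
  · have hcoord : Integrable (fun μ : stdSimplex ℝ Ω => (μ : Ω → ℝ) ω)
        (τ : Measure (stdSimplex ℝ Ω)) :=
      Integrable.of_bound ((measurable_pi_apply ω).comp measurable_subtype_coe).aestronglyMeasurable
        1 (Eventually.of_forall fun μ => abs_apply_le_one μ ω)
    rw [integral_congr_ae (hVs.mono fun μ hμ => by
      rw [hμ]), integral_const_mul, integral_sub hcoord (integrable_const _), hbp ω]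
    simp
  · rw [integral_congr_ae hVs]
    simp

end Mediation

end

theorem theorem3 {Ω A : Type*} [Fintype Ω] [MetricSpace A] [CompactSpace A] [Nonempty A]
    (uS : A → ℝ) (huS : Continuous uS)
    (uR : Ω → A → ℝ) (huR : ∀ ω, Continuous (uR ω))
    (p : Ω → ℝ) (hp : p ∈ stdSimplex ℝ Ω) (hpos : ∀ ω, 0 < p ω)
    (s : ℝ) (hs : Mediation.upperValue uS uR p ≤ s)
    (hatt : Mediation.AttainableCT uS uR p s) :
    (Mediation.LocallyImprovable uS uR p s → s < Mediation.mediationValue uS uR p) ∧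
    (¬ Mediation.Improvable uS uR p s →
      ((∀ μ ∈ stdSimplex ℝ Ω, s ≤ Mediation.lowerCT uS uR μ) →
        Mediation.upperCT uS uR p ≤ s) →
      Mediation.mediationValue uS uR p = s) := by
  obtain ⟨M, hM⟩ := Mediation.exists_forall_abs_le huS
  have hbdd := Mediation.bddAbove_mediationValues (uR := uR) hM p
  constructor
  · rintro ⟨μ, ⟨τ, hτ, hfin, hμ, hμΔ⟩, t, ht, hup, hlow⟩
    have hxΔ : t • μ + (1 - t) • p ∈ stdSimplex ℝ Ω :=
      convex_stdSimplex ℝ Ω hμΔ hp ht.1 (sub_nonneg.2 ht.2.le) (by ring)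
    obtain ⟨c₁, hc₁, hx⟩ := Mediation.exists_gt_mem_convexHull_valueCorr huS huR
      ((Mediation.lt_upperCT_iff huS huR hxΔ).1 hup)
    obtain ⟨c₂, hc₂, hy⟩ := Mediation.exists_lt_mem_convexHull_valueCorr huS huR
      ((Mediation.lowerCT_lt_iff huS huR hμΔ).1 hlow)
    obtain ⟨v, hv, h⟩ := Mediation.exists_mediationFeasible_gt hτ hfin hμ ht hc₁ hc₂ hx hy
    exact lt_of_lt_of_le hv (le_csSup hbdd h)
  · intro himp hdeg
    have hmem := Mediation.exists_mediationFeasible_of_attainableCT hatt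
    refine le_antisymm (csSup_le ⟨s, hmem⟩ ?_) (le_csSup hbdd hmem)
    rintro _ ⟨τ, V, hV, rfl⟩
    exact Mediation.integral_le_of_not_improvable huS huR hp himp hdeg hV
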